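/- Let $n\ge 0$, $0<p<1$, and let $\mu$ be the $p$-biased measure on $\{-1,1\}^n$, i.e. the product measure giving each coordinate the value $1$ with probability $p$ and $-1$ with probability $1-p$. Put $\chi_S(x)=\prod_{i\in S}\frac{x_i-(2p-1)}{\sigma}$ with $\sigma^2=4p(1-p)$ the variance of a coordinate, $\hat f(S)=\int f\chi_S\,d\mu$, and $T_\delta f=\sum_{S\subseteq[n]}\delta^{|S|}\hat f(S)\chi_S$ for $f:\{-1,1\}^n\to\mathbb R$. All norms are $L^q(\mu)$ norms. Let $\lambda=\min\{p,1-p\}$. Then for every $f:\{-1,1\}^n\to\mathbb R$ and every $2\le q\le\infty$, $$\|T_\gamma f\|_q\le\|f\|_2,\qquad \gamma=\frac{1}{\sqrt{q-1}}\,\rho(q)\quad(\gamma=0\text{ if }q=\infty),$$ where $\rho(q)$ is any one of the following: (i) $\rho(q)=\lambda^{\frac12-\frac1q}$; (ii) $\rho(q)=\sqrt{q-1}\,\sqrt{\dfrac{\sinh\left(-\frac1q\ln\frac{\lambda}{1-\lambda}\right)}{\sinh\left(-\left(1-\frac1q\right)\ln\frac{\lambda}{1-\lambda}\right)}}$, which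 for $\lambda=\frac12$ is understood as its limit $1$ as $\lambda\to\frac12$; (iii) $\rho(q)=\sqrt{\dfrac{\lambda}{1-\lambda}}$. -/

import Mathlib

open MeasureTheory
open scoped ENNReal

noncomputable section

namespace BiasedCube

/-- All subsets of `{-1, 1}` are measurable. -/
instance instDiscreteUnits : DiscreteMeasurableSpace ℤˣ where
  forall_measurableSet s :=
    ⟨Units.val '' s, MeasurableSet.of_discrete, Set.preimage_image_eq s Units.val_injective⟩

/-- The measure on `{-1, 1}` (modelled by `ℤˣ`) with weight `p` at `1` and `1 - p` at `-1`. -/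
def coin (p : ℝ) : Measure ℤˣ :=
  ENNReal.ofReal p • Measure.dirac 1 + ENNReal.ofReal (1 - p) • Measure.dirac (-1)

/-- The `p`-biased measure on the hypercube `{-1, 1}^n`. -/
def mu (n : ℕ) (p : ℝ) : Measure (Fin n → ℤˣ) :=
  Measure.pi fun _ => coin p

/-- The embedding of `{-1, 1}` into the reals. -/
def toReal (t : ℤˣ) : ℝ := ((t : ℤ) : ℝ)

/-- The mean of a coordinate. -/
def mean (p : ℝ) : ℝ := ∫ t, toReal t ∂(coin p)

/-- The standard deviation of a coordinate. -/
def sd (p : ℝ) : ℝ := √(∫ t, (toReal t - mean p) ^ 2 ∂(coin p))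

/-- The basis function `χ_S = ∏_{i ∈ S} χ_i`, where `χ_i(x) = (x_i - E x_i) / σ`. -/
def chi {n : ℕ} (p : ℝ) (S : Finset (Fin n)) (x : Fin n → ℤˣ) : ℝ :=
  ∏ i ∈ S, (1 / sd p) * (toReal (x i) - mean p)

/-- The Fourier coefficient `⟨f, χ_S⟩`. -/
def fourierCoeff {n : ℕ} (p : ℝ) (f : (Fin n → ℤˣ) → ℝ) (S : Finset (Fin n)) : ℝ :=
  ∫ x, f x * chi p S x ∂(mu n p)

/-- The smoothing operator `T_δ f = ∑_S δ^|S| f̂(S) χ_S`. -/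
def smooth {n : ℕ} (p δ : ℝ) (f : (Fin n → ℤˣ) → ℝ) (x : Fin n → ℤˣ) : ℝ :=
  ∑ S : Finset (Fin n), δ ^ S.card * fourierCoeff p f S * chi p S x

/-- `λ = min {p, 1 - p}`. -/
def lam (p : ℝ) : ℝ := min p (1 - p)

/-- The first smoothing parameter. -/
def rhoPow (p q : ℝ) : ℝ := lam p ^ (1 / 2 - 1 / q)

/-- The second smoothing parameter. For `λ = 1/2` the quotient of hyperbolic sines is `0 / 0`;
it tends to `1 / (q - 1)` as `λ → 1/2`, so that the parameter is then `1`. -/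
def rhoSinh (p q : ℝ) : ℝ :=
  if lam p = 1 / 2 then 1
  else √(q - 1) * √(Real.sinh (-(1 / q) * Real.log (lam p / (1 - lam p))) /
    Real.sinh (-(1 - 1 / q) * Real.log (lam p / (1 - lam p))))

/-- The third smoothing parameter (it does not depend on `q`). -/
def rhoRatio (p _q : ℝ) : ℝ := √(lam p / (1 - lam p))

/-- `γ = ρ(q) / √(q - 1)` for finite `q`, and `γ = 0`, its limit, for `q = ∞`. -/
def gam (ρ : ℝ → ℝ) (q : ℝ≥0∞) : ℝ :=
  if q = ∞ then 0 else 1 / √(q.toReal - 1) * ρ q.toReal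

end BiasedCube

end

namespace BiasedCube

/-! By duality, the case of one coordinate is `⟨T F, H⟩ ≤ ‖F‖₂ ‖H‖_r` with `r = q/(q-1)`; by
Cauchy–Schwarz it follows from the two-point inequality `(E H)² + δ² Var H ≤ ‖H‖_r²` (`two_point`).
The bilinear form has a nonnegative kernel and tensorizes by induction on `n`
(`sum_prod_kernel_le`); testing it on `|f|` and `|T f|^(q-1)` gives the theorem for finite `q`.

For the two-point inequality let the weights have ratio `e^u`, `u ≥ 0`, and the values of `H` ratio
`e^(2η)`. With `g = hyperRatio u q` in place of `δ²`, both sides become even functions of `θ = η +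
u/(2r)`, and the claim is that `log (B + A cosh 2θ) - (2/r) log cosh rθ` is largest on `θ ≥ 0` at
`θ₀ = u/(2r)`, i.e. for constant `H` (`cosh_add_cosh_le`). The sign of its derivative is decided by
the monotone quotient `sinh (rθ) / sinh ((2-r)θ)`.

Parameter (ii) gives `γ² = hyperRatio` exactly; (i) and (iii) give smaller values, by Bernoulli's
inequality (`exp_mul_le_hyperRatio`). -/

/-! ### Monotonicity of quotients of hyperbolic functions. -/

lemma mul_sinh_le_mul_sinh {a b x : ℝ} (ha : 0 ≤ a) (hab : a ≤ b) (hx : 0 ≤ x) :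
    b * Real.sinh (a * x) ≤ a * Real.sinh (b * x) := by
  have hd : ∀ y : ℝ, HasDerivAt (fun y => a * Real.sinh (b * y) - b * Real.sinh (a * y))
      (a * (Real.cosh (b * y) * (b * 1)) - b * (Real.cosh (a * y) * (a * 1))) y := fun y =>
    ((((hasDerivAt_id y).const_mul b).sinh.const_mul a).sub
      (((hasDerivAt_id y).const_mul a).sinh.const_mul b))
  have hm : MonotoneOn (fun y => a * Real.sinh (b * y) - b * Real.sinh (a * y)) (Set.Ici 0) := by
    apply monotoneOn_of_deriv_nonneg (convex_Ici 0)
    · exact fun y _ => (hd y).continuousAt.continuousWithinAt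
    · exact fun y _ => (hd y).differentiableAt.differentiableWithinAt
    · intro y hy
      rw [interior_Ici, Set.mem_Ioi] at hy
      rw [(hd y).deriv]
      have h1 : Real.cosh (a * y) ≤ Real.cosh (b * y) := by
        rw [Real.cosh_le_cosh, abs_of_nonneg (by positivity),
          abs_of_nonneg (mul_nonneg (ha.trans hab) hy.le)]
        gcongr
      nlinarith [mul_le_mul_of_nonneg_left h1 (mul_nonneg ha (ha.trans hab))]
  have := hm (Set.mem_Ici.2 le_rfl) (Set.mem_Ici.2 hx) hx
  simp at this
  exact this

/-- This is the previous lemma for `b - a` and `b + a`, expanded by the addition formulas. It makes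
the derivative of `sinh (bx) / sinh (ax)` nonnegative. -/
lemma mul_sinh_mul_cosh_le {a b x : ℝ} (ha : 0 ≤ a) (hab : a ≤ b) (hx : 0 ≤ x) :
    a * (Real.sinh (b * x) * Real.cosh (a * x)) ≤ b * (Real.cosh (b * x) * Real.sinh (a * x)) := by
  have h := mul_sinh_le_mul_sinh (a := b - a) (b := b + a) (x := x)
    (sub_nonneg.2 hab) (by linarith) hx
  have e1 : Real.sinh ((b - a) * x) = Real.sinh (b * x) * Real.cosh (a * x)
      - Real.cosh (b * x) * Real.sinh (a * x) := by rw [sub_mul, Real.sinh_sub]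
  have e2 : Real.sinh ((b + a) * x) = Real.sinh (b * x) * Real.cosh (a * x)
      + Real.cosh (b * x) * Real.sinh (a * x) := by rw [add_mul, Real.sinh_add]
  rw [e1, e2] at h
  linarith

lemma sinh_mul_sinh_le {a b x y : ℝ} (ha : 0 < a) (hab : a ≤ b) (hx : 0 ≤ x) (hxy : x ≤ y) :
    Real.sinh (a * y) * Real.sinh (b * x) ≤ Real.sinh (a * x) * Real.sinh (b * y) := by
  rcases hx.eq_or_lt with rfl | hx
  · simp
  have hpos : ∀ z : ℝ, 0 < z → 0 < Real.sinh (a * z) := fun z hz => by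
    rw [Real.sinh_pos_iff]; positivity
  have hd : ∀ z : ℝ, 0 < z → HasDerivAt (fun z => Real.sinh (b * z) / Real.sinh (a * z))
      (((Real.cosh (b * z) * (b * 1)) * Real.sinh (a * z) -
        Real.sinh (b * z) * (Real.cosh (a * z) * (a * 1))) / Real.sinh (a * z) ^ 2) z :=
    fun z hz => (((hasDerivAt_id z).const_mul b).sinh).div
      (((hasDerivAt_id z).const_mul a).sinh) (hpos z hz).ne'
  have hm : MonotoneOn (fun z => Real.sinh (b * z) / Real.sinh (a * z)) (Set.Ioi 0) := by
    apply monotoneOn_of_deriv_nonneg (convex_Ioi 0)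
    · exact fun z hz => (hd z hz).continuousAt.continuousWithinAt
    · exact fun z hz =>
        (hd z (interior_subset hz)).differentiableAt.differentiableWithinAt
    · intro z hz
      have hz : 0 < z := interior_subset hz
      rw [(hd z hz).deriv]
      apply div_nonneg _ (sq_nonneg _)
      linarith [mul_sinh_mul_cosh_le ha.le hab hz.le]
  have := hm (Set.mem_Ioi.2 hx) (Set.mem_Ioi.2 (hx.trans_le hxy)) hxy
  simp only at this
  rw [div_le_div_iff₀ (hpos x hx) (hpos y (hx.trans_le hxy))] at this
  linarith

/-- A quotient of powers of hyperbolic cosines on a half line, compared with its value at the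
point where its derivative changes sign. -/
lemma log_cosh_le {A B r θ₀ θ : ℝ} (hA : 0 < A) (hB : 0 ≤ B) (hr : 0 < r)
    (hθ₀ : 0 ≤ θ₀) (hθ : 0 ≤ θ)
    (hlt : ∀ z, 0 ≤ z → z ≤ θ₀ → B * Real.sinh (r * z) ≤ A * Real.sinh ((2 - r) * z))
    (hgt : ∀ z, θ₀ ≤ z → A * Real.sinh ((2 - r) * z) ≤ B * Real.sinh (r * z)) :
    Real.log (B + A * Real.cosh (2 * θ)) - 2 / r * Real.log (Real.cosh (r * θ)) ≤
      Real.log (B + A * Real.cosh (2 * θ₀)) - 2 / r * Real.log (Real.cosh (r * θ₀)) := by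
  have hpos : ∀ z : ℝ, 0 < B + A * Real.cosh (2 * z) := fun z => by
    have := Real.cosh_pos (2 * z); positivity
  have hd : ∀ z : ℝ, HasDerivAt
      (fun z => Real.log (B + A * Real.cosh (2 * z)) - 2 / r * Real.log (Real.cosh (r * z)))
      ((A * (Real.sinh (2 * z) * (2 * 1))) / (B + A * Real.cosh (2 * z)) -
        2 / r * ((Real.sinh (r * z) * (r * 1)) / Real.cosh (r * z))) z := fun z =>
    ((((((hasDerivAt_id z).const_mul 2).cosh).const_mul A).const_add B).log (hpos z).ne').sub
      (((((hasDerivAt_id z).const_mul r).cosh).log (Real.cosh_pos _).ne').const_mul (2 / r))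
  -- Over the common denominator, `sinh 2z cosh rz - cosh 2z sinh rz` collapses to `sinh ((2-r)z)`.
  have hd' : ∀ z : ℝ, deriv
      (fun z => Real.log (B + A * Real.cosh (2 * z)) - 2 / r * Real.log (Real.cosh (r * z))) z =
      2 * (A * Real.sinh ((2 - r) * z) - B * Real.sinh (r * z)) /
        ((B + A * Real.cosh (2 * z)) * Real.cosh (r * z)) := fun z => by
    have h1 := (hpos z).ne'
    have h2 := (Real.cosh_pos (r * z)).ne'
    rw [(hd z).deriv, sub_mul 2 r z, Real.sinh_sub]
    field_simp
    ring
  rcases le_total θ θ₀ with h | h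
  · have hm : MonotoneOn (fun z => Real.log (B + A * Real.cosh (2 * z)) -
        2 / r * Real.log (Real.cosh (r * z))) (Set.Icc 0 θ₀) := by
      apply monotoneOn_of_deriv_nonneg (convex_Icc 0 θ₀)
      · exact fun z _ => (hd z).continuousAt.continuousWithinAt
      · exact fun z _ => (hd z).differentiableAt.differentiableWithinAt
      · intro z hz
        have hz : z ∈ Set.Icc 0 θ₀ := interior_subset hz
        rw [hd']
        refine div_nonneg ?_ (mul_pos (hpos z) (Real.cosh_pos _)).le
        linarith [hlt z hz.1 hz.2]
    exact hm ⟨hθ, h⟩ ⟨hθ₀, le_rfl⟩ h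
  · have hm : AntitoneOn (fun z => Real.log (B + A * Real.cosh (2 * z)) -
        2 / r * Real.log (Real.cosh (r * z))) (Set.Ici θ₀) := by
      apply antitoneOn_of_deriv_nonpos (convex_Ici θ₀)
      · exact fun z _ => (hd z).continuousAt.continuousWithinAt
      · exact fun z _ => (hd z).differentiableAt.differentiableWithinAt
      · intro z hz
        have hz : z ∈ Set.Ici θ₀ := interior_subset hz
        rw [hd']
        refine div_nonpos_of_nonpos_of_nonneg ?_ (mul_pos (hpos z) (Real.cosh_pos _)).le
        linarith [hgt z hz]
    exact hm (Set.mem_Ici.2 le_rfl) (Set.mem_Ici.2 h) h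

/-! ### The squared smoothing parameter and its bounds. -/

/-- The square of the optimal smoothing parameter from `L²` to `L^q` for a two-point space whose
weights have ratio `exp u`. -/
noncomputable def hyperRatio (u q : ℝ) : ℝ :=
  if u = 0 then 1 / (q - 1) else Real.sinh (u / q) / Real.sinh (u - u / q)

lemma div_le_sub_div {u q : ℝ} (hu : 0 ≤ u) (hq : 2 ≤ q) : u / q ≤ u - u / q := by
  have : u / q ≤ u / 2 := by gcongr
  linarith

lemma hyperRatio_nonneg {u q : ℝ} (hu : 0 ≤ u) (hq : 2 ≤ q) : 0 ≤ hyperRatio u q := by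
  have h1 : 0 ≤ u / q := by positivity
  unfold hyperRatio
  split_ifs with h
  · exact div_nonneg zero_le_one (by linarith)
  · exact div_nonneg (Real.sinh_nonneg_iff.2 h1)
      (Real.sinh_nonneg_iff.2 (h1.trans (div_le_sub_div hu hq)))

lemma hyperRatio_le_one {u q : ℝ} (hu : 0 ≤ u) (hq : 2 ≤ q) : hyperRatio u q ≤ 1 := by
  have h1 : 0 ≤ u / q := by positivity
  unfold hyperRatio
  split_ifs with h
  · rw [div_le_one (by linarith)]; linarith
  · exact div_le_one_of_le₀ (Real.sinh_le_sinh.2 (div_le_sub_div hu hq))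
      (Real.sinh_nonneg_iff.2 (h1.trans (div_le_sub_div hu hq)))

lemma sinh_sub_div_pos {u q : ℝ} (hu : 0 < u) (hq : 2 ≤ q) : 0 < Real.sinh (u - u / q) := by
  have h1 : 0 < u / q := by positivity
  exact Real.sinh_pos_iff.2 (h1.trans_le (div_le_sub_div hu.le hq))

lemma hyperRatio_mul_sinh {u q : ℝ} (hu : 0 ≤ u) (hq : 2 ≤ q) :
    hyperRatio u q * Real.sinh (u - u / q) = Real.sinh (u / q) := by
  rcases hu.eq_or_lt with rfl | hu
  · simp
  · rw [hyperRatio, if_neg hu.ne', div_mul_cancel₀ _ (sinh_sub_div_pos hu hq).ne']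

/-- With `v = u/q`, clearing denominators and dividing by `e^v/2` leaves `1 - x^(q-1) ≤ (q-1)(1-x)`
for `x = e^(-2v)`, which is Bernoulli's inequality. -/
lemma exp_mul_le_hyperRatio {u q : ℝ} (hu : 0 ≤ u) (hq : 2 ≤ q) :
    1 / (q - 1) * Real.exp (-(1 - 2 / q) * u) ≤ hyperRatio u q := by
  rcases hu.eq_or_lt with rfl | hu
  · simp [hyperRatio]
  rw [hyperRatio, if_neg hu.ne', le_div_iff₀ (sinh_sub_div_pos hu hq), mul_assoc,
    div_mul_eq_mul_div, one_mul, div_le_iff₀ (by linarith)]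
  have hB := one_add_mul_self_le_rpow_one_add (s := Real.exp (-2 * (u / q)) - 1) (p := q - 1)
    (by linarith [Real.exp_pos (-2 * (u / q))]) (by linarith)
  rw [add_sub_cancel, ← Real.exp_mul] at hB
  have hq0 : q ≠ 0 := by linarith
  have e0 : u - u / q = (q - 1) * (u / q) := by field_simp
  have e1 : Real.exp (-(1 - 2 / q) * u) * Real.sinh (u - u / q) =
      Real.exp (u / q) * (1 - Real.exp (-2 * (u / q) * (q - 1))) / 2 := by
    rw [Real.sinh_eq, ← mul_div_assoc, mul_sub, mul_sub, ← Real.exp_add, ← Real.exp_add,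
      ← Real.exp_add, mul_one]
    have h1 : -(1 - 2 / q) * u + (u - u / q) = u / q := by ring
    have h2 : -(1 - 2 / q) * u + -(u - u / q) = u / q + -2 * (u / q) * (q - 1) := by
      field_simp; ring
    rw [h1, h2]
  have e2 : Real.sinh (u / q) * (q - 1) =
      Real.exp (u / q) * (-((q - 1) * (Real.exp (-2 * (u / q)) - 1))) / 2 := by
    have : Real.exp (-(u / q)) = Real.exp (u / q) * Real.exp (-2 * (u / q)) := by
      rw [← Real.exp_add]; congr 1; ring
    rw [Real.sinh_eq, this]; ring
  rw [e1, e2]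
  have := Real.exp_pos (u / q)
  gcongr
  linarith

end BiasedCube

/-! ### The two-point inequality. -/

namespace BiasedCube

/-- The two-point inequality in hyperbolic coordinates. -/
lemma cosh_add_cosh_le {u q r : ℝ} (hu : 0 ≤ u) (hq : 2 < q) (hr : r = q / (q - 1)) (η : ℝ) :
    (1 - hyperRatio u q + Real.cosh (u + 2 * η) + hyperRatio u q * Real.cosh (2 * η)) / 2 /
        Real.cosh (u / 2) ^ 2 ≤
      (Real.cosh (u / 2 + r * η) / Real.cosh (u / 2)) ^ (2 / r) := by
  have hq1 : 0 < q - 1 := by linarith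
  have hq0 : 0 < q := by linarith
  have hr1 : 1 < r := by rw [hr, lt_div_iff₀ hq1]; linarith
  have hr2 : r < 2 := by rw [hr, div_lt_iff₀ hq1]; linarith
  have hr0 : 0 < r := by linarith
  have hur : u / r = u - u / q := by rw [hr]; field_simp
  have hg1 := hyperRatio_le_one hu hq.le
  have hg0 := hyperRatio_nonneg hu hq.le
  have hgs := hyperRatio_mul_sinh hu hq.le
  have hgu : u = 0 → hyperRatio u q = r - 1 := fun h => by
    rw [hyperRatio, if_pos h, hr]; field_simp; ring
  set g := hyperRatio u q
  obtain ⟨θ₀, hθ₀⟩ : ∃ θ₀, θ₀ = u / (2 * r) := ⟨_, rfl⟩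
  have hθ₀0 : 0 ≤ θ₀ := by rw [hθ₀]; positivity
  have hw : u - u / q = 2 * θ₀ := by rw [← hur, hθ₀]; field_simp
  have hrθ : r * θ₀ = u / 2 := by rw [hθ₀]; field_simp
  have hrθ' : (2 - r) * θ₀ = 2 * θ₀ - u / 2 := by rw [← hrθ]; ring
  have hv : u / q = u - 2 * θ₀ := by linarith
  rw [hw, hv] at hgs
  obtain ⟨A, hA⟩ : ∃ A, A = Real.cosh (u - 2 * θ₀) + g * Real.cosh (2 * θ₀) := ⟨_, rfl⟩
  have hA0 : 0 < A := by
    rw [hA]; have := Real.cosh_pos (u - 2 * θ₀); have := Real.cosh_pos (2 * θ₀); positivity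
  -- Expanding around `2(η + θ₀)`, the coefficient of the hyperbolic sine is `sinh (u - 2θ₀) - g
  -- sinh 2θ₀`, and the choice of `g` makes it vanish.
  have hN : ∀ η : ℝ, 1 - g + Real.cosh (u + 2 * η) + g * Real.cosh (2 * η) =
      (1 - g) + A * Real.cosh (2 * (η + θ₀)) := fun η => by
    have e1 : u + 2 * η = 2 * (η + θ₀) + (u - 2 * θ₀) := by ring
    have e2 : Real.cosh (2 * η) = Real.cosh (2 * (η + θ₀) - 2 * θ₀) := by congr 1; ring
    rw [e1, e2, Real.cosh_add, Real.cosh_sub (2 * (η + θ₀)), hA, ← hgs]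
    ring
  have hAs : A * Real.sinh (2 * θ₀) = 2 * Real.cosh (u / 2) * Real.sinh (r * θ₀) := by
    have h1 : Real.sinh u = Real.sinh (2 * θ₀ + (u - 2 * θ₀)) := by congr 1; ring
    have h2 : Real.sinh u = 2 * Real.sinh (u / 2) * Real.cosh (u / 2) := by
      rw [← Real.sinh_two_mul]; congr 1; ring
    rw [Real.sinh_add, ← hgs, h2] at h1
    rw [hrθ, hA]; linear_combination -h1
  have hBs : (1 - g) * Real.sinh (2 * θ₀) =
      2 * Real.cosh (u / 2) * Real.sinh ((2 - r) * θ₀) := by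
    have h1 : Real.sinh (2 * θ₀) = Real.sinh (u / 2 + (2 - r) * θ₀) := by
      rw [hrθ']; congr 1; ring
    have h2 : Real.sinh (u - 2 * θ₀) = Real.sinh (u / 2 - (2 - r) * θ₀) := by
      rw [hrθ']; congr 1; ring
    rw [sub_mul, hgs, h1, h2, Real.sinh_add, Real.sinh_sub]; ring
  have hC := Real.cosh_pos (u / 2)
  have hs : 0 < u → 0 < Real.sinh (2 * θ₀) := fun h => by
    rw [Real.sinh_pos_iff, hθ₀]; positivity
  -- By `hAs` and `hBs`, the derivative vanishes at `θ₀`; for `u > 0` the monotone quotient gives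
  -- its sign on either side.
  have key := log_cosh_le (A := A) (B := 1 - g) (r := r) (θ₀ := θ₀) (θ := |η + θ₀|) hA0
    (by linarith) hr0 hθ₀0 (abs_nonneg _)
    (by
      intro z hz hz'
      rcases hu.eq_or_lt with h | h
      · have : θ₀ = 0 := by rw [hθ₀, ← h]; simp
        have : z = 0 := by linarith
        simp [this]
      · refine le_of_mul_le_mul_right ?_ (hs h)
        have := sinh_mul_sinh_le (a := 2 - r) (b := r) (by linarith) (by linarith) hz hz'
        calc _ = (1 - g) * Real.sinh (2 * θ₀) * Real.sinh (r * z) := by ring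
          _ = 2 * Real.cosh (u / 2) * (Real.sinh ((2 - r) * θ₀) * Real.sinh (r * z)) := by
            rw [hBs]; ring
          _ ≤ 2 * Real.cosh (u / 2) * (Real.sinh ((2 - r) * z) * Real.sinh (r * θ₀)) := by gcongr
          _ = A * Real.sinh (2 * θ₀) * Real.sinh ((2 - r) * z) := by rw [hAs]; ring
          _ = _ := by ring)
    (by
      intro z hz
      rcases hu.eq_or_lt with h | h
      -- Here `θ₀ = 0`, so the quotient cannot be compared with its value at `θ₀`; instead `A = r`
      -- and `1 - g = 2 - r`, and the first lemma applies.
      · have h0 : θ₀ = 0 := by rw [hθ₀, ← h]; simp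
        have hA' : A = r := by rw [hA, h0, ← h, hgu h.symm]; simp
        rw [hA', hgu h.symm]
        have := mul_sinh_le_mul_sinh (a := 2 - r) (b := r) (x := z) (by linarith) (by linarith)
          (by linarith)
        linarith
      · refine le_of_mul_le_mul_right ?_ (hs h)
        have := sinh_mul_sinh_le (a := 2 - r) (b := r) (by linarith) (by linarith) hθ₀0 hz
        calc _ = A * Real.sinh (2 * θ₀) * Real.sinh ((2 - r) * z) := by ring
          _ = 2 * Real.cosh (u / 2) * (Real.sinh ((2 - r) * z) * Real.sinh (r * θ₀)) := by
            rw [hAs]; ring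
          _ ≤ 2 * Real.cosh (u / 2) * (Real.sinh ((2 - r) * θ₀) * Real.sinh (r * z)) := by gcongr
          _ = (1 - g) * Real.sinh (2 * θ₀) * Real.sinh (r * z) := by rw [hBs]; ring
          _ = _ := by ring)
  have c1 : Real.cosh (2 * |η + θ₀|) = Real.cosh (2 * (η + θ₀)) := by
    rw [← Real.cosh_abs (2 * (η + θ₀)), abs_mul, abs_two]
  have c2 : Real.cosh (r * |η + θ₀|) = Real.cosh (u / 2 + r * η) := by
    have : u / 2 + r * η = r * (η + θ₀) := by rw [mul_add, hrθ]; ring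
    rw [this, ← Real.cosh_abs (r * (η + θ₀)), abs_mul, abs_of_pos hr0]
  have h0 := hN 0
  have c3 : Real.cosh u = 2 * Real.cosh (u / 2) ^ 2 - 1 := by
    have := Real.cosh_two_mul (u / 2)
    have h2 := Real.cosh_sq (u / 2)
    rw [mul_div_cancel₀ _ two_ne_zero] at this
    linarith
  simp only [mul_zero, add_zero, zero_add, Real.cosh_zero, mul_one] at h0
  -- The case `η = 0`: the maximal value is the one that makes the two-point inequality an equality.
  have h0' : (1 - g) + A * Real.cosh (2 * θ₀) = 2 * Real.cosh (u / 2) ^ 2 := by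
    rw [← h0, c3]; ring
  have hD := Real.cosh_pos (u / 2 + r * η)
  have hNp : 0 < (1 - g) + A * Real.cosh (2 * (η + θ₀)) := by
    have := Real.cosh_pos (2 * (η + θ₀)); have : 0 ≤ 1 - g := by linarith
    positivity
  rw [c1, c2, h0', hrθ, Real.log_mul two_ne_zero (by positivity)] at key
  rw [hN, ← Real.log_le_log_iff (by positivity) (by positivity), Real.log_rpow (by positivity),
    Real.log_div (by positivity) (by positivity), Real.log_div (by positivity) two_ne_zero,
    Real.log_div hD.ne' hC.ne']
  linarith

lemma two_point_of_pos {p u q r s t : ℝ} (hp0 : 0 < p) (hp : p ≤ 1 - p)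
    (hu : u = Real.log ((1 - p) / p)) (hq : 2 < q) (hr : r = q / (q - 1))
    (hs : 0 < s) (ht : 0 < t) :
    (p * s + (1 - p) * t) ^ 2 + hyperRatio u q * (p * (1 - p) * (s - t) ^ 2) ≤
      (p * s ^ r + (1 - p) * t ^ r) ^ (2 / r) := by
  have hu0 : 0 ≤ u := by rw [hu]; exact Real.log_nonneg ((one_le_div hp0).2 hp)
  have hr0 : 0 < r := by rw [hr]; apply div_pos <;> linarith
  have hC := Real.cosh_pos (u / 2)
  have hE : Real.exp (u / 2) * Real.exp (u / 2) * p = 1 - p := by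
    rw [← Real.exp_add, add_halves, hu, Real.exp_log (div_pos (by linarith) hp0),
      div_mul_cancel₀ _ hp0.ne']
  have hE' : Real.exp (-(u / 2)) * Real.exp (u / 2) = 1 := by rw [← Real.exp_add]; simp
  have hp1 : p = Real.exp (-(u / 2)) / (2 * Real.cosh (u / 2)) := by
    rw [eq_div_iff (by positivity), Real.cosh_eq]
    linear_combination Real.exp (-(u / 2)) * hE - Real.exp (u / 2) * p * hE'
  have hp2 : 1 - p = Real.exp (u / 2) / (2 * Real.cosh (u / 2)) := by
    rw [eq_div_iff (by positivity), Real.cosh_eq]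
    linear_combination -Real.exp (-(u / 2)) * hE + Real.exp (u / 2) * p * hE'
  -- Both sides are homogeneous of degree 2 in `(s, t)`, so the geometric mean `e^c` factors out and
  -- only `η` remains.
  obtain ⟨c, hc⟩ : ∃ c, c = (Real.log s + Real.log t) / 2 := ⟨_, rfl⟩
  obtain ⟨η, hη⟩ : ∃ η, η = (Real.log t - Real.log s) / 2 := ⟨_, rfl⟩
  have hs' : s = Real.exp (c - η) := by
    rw [← Real.exp_log hs, hc, hη]; congr 1; ring
  have ht' : t = Real.exp (c + η) := by
    rw [← Real.exp_log ht, hc, hη]; congr 1; ring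
  have hsum : ∀ z w : ℝ, p * Real.exp (z - w) + (1 - p) * Real.exp (z + w) =
      Real.exp z * (Real.cosh (u / 2 + w) / Real.cosh (u / 2)) := fun z w => by
    rw [hp2, hp1, Real.cosh_eq (u / 2 + w), neg_add, Real.exp_add (u / 2), Real.exp_add (-(u / 2)),
      sub_eq_add_neg, Real.exp_add, Real.exp_add]
    field_simp
    ring
  have key := cosh_add_cosh_le hu0 hq hr η
  have e1 : s ^ r = Real.exp (c * r - r * η) := by
    rw [hs', ← Real.exp_mul]; congr 1; ring
  have e2 : t ^ r = Real.exp (c * r + r * η) := by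
    rw [ht', ← Real.exp_mul]; congr 1; ring
  have e3 : Real.exp (c * r) ^ (2 / r) = Real.exp c ^ 2 := by
    rw [← Real.exp_mul, ← Real.exp_nat_mul]; congr 1; field_simp; norm_num
  rw [e1, e2, hsum, Real.mul_rpow (Real.exp_pos _).le
    (div_nonneg (Real.cosh_pos _).le hC.le), e3]
  have e4 : (s - t) ^ 2 = Real.exp c ^ 2 * (4 * Real.sinh η ^ 2) := by
    rw [hs', ht', Real.sinh_eq, sub_eq_add_neg c, Real.exp_add, Real.exp_add]; ring
  have e5 : p * (1 - p) = 1 / (4 * Real.cosh (u / 2) ^ 2) := by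
    rw [hp2, hp1, div_mul_div_comm, hE']; ring
  rw [e4, e5, hs', ht', hsum, mul_pow]
  have e6 : Real.cosh (u + 2 * η) = 2 * Real.cosh (u / 2 + η) ^ 2 - 1 := by
    have h1 := Real.cosh_two_mul (u / 2 + η)
    have h2 := Real.cosh_sq (u / 2 + η)
    have : u + 2 * η = 2 * (u / 2 + η) := by ring
    rw [this]; linarith
  have e7 : Real.cosh (2 * η) = 2 * Real.sinh η ^ 2 + 1 := by
    have h1 := Real.cosh_two_mul η
    have h2 := Real.cosh_sq η
    linarith
  refine le_trans (le_of_eq ?_) (mul_le_mul_of_nonneg_left key (sq_nonneg (Real.exp c)))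
  rw [e6, e7]
  field_simp
  ring

lemma two_point {p u q r s t : ℝ} (hp0 : 0 < p) (hp : p ≤ 1 - p)
    (hu : u = Real.log ((1 - p) / p)) (hq : 2 ≤ q) (hr : r = q / (q - 1))
    (hs : 0 ≤ s) (ht : 0 ≤ t) :
    (p * s + (1 - p) * t) ^ 2 + hyperRatio u q * (p * (1 - p) * (s - t) ^ 2) ≤
      (p * s ^ r + (1 - p) * t ^ r) ^ (2 / r) := by
  have hu0 : 0 ≤ u := by rw [hu]; exact Real.log_nonneg ((one_le_div hp0).2 hp)
  have hr0 : 0 < r := by rw [hr]; apply div_pos <;> linarith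
  rcases hq.eq_or_lt with rfl | hq
  · have hr : r = 2 := by rw [hr]; norm_num
    have := hyperRatio_le_one hu0 le_rfl
    have h2 : 0 ≤ p * (1 - p) * (s - t) ^ 2 :=
      mul_nonneg (mul_nonneg hp0.le (by linarith)) (sq_nonneg _)
    rw [hr, div_self two_ne_zero, Real.rpow_one, Real.rpow_two, Real.rpow_two]
    nlinarith [mul_le_mul_of_nonneg_right this h2]
  -- The logarithmic coordinates need `s, t > 0`; zero values are reached by letting `ε → 0⁺`.
  have hc : ∀ a : ℝ, Continuous fun ε : ℝ => (a + ε) ^ r := fun a =>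
    (continuous_const.add continuous_id).rpow_const fun _ => Or.inr hr0.le
  have h1 : Filter.Tendsto (fun ε : ℝ => (p * (s + ε) + (1 - p) * (t + ε)) ^ 2 +
      hyperRatio u q * (p * (1 - p) * ((s + ε) - (t + ε)) ^ 2)) (nhdsWithin 0 (Set.Ioi 0))
      (nhds ((p * (s + 0) + (1 - p) * (t + 0)) ^ 2 +
      hyperRatio u q * (p * (1 - p) * ((s + 0) - (t + 0)) ^ 2))) :=
    tendsto_nhdsWithin_of_tendsto_nhds (Continuous.tendsto (by fun_prop) 0)
  have h2 : Filter.Tendsto (fun ε : ℝ => (p * (s + ε) ^ r + (1 - p) * (t + ε) ^ r) ^ (2 / r))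
      (nhdsWithin 0 (Set.Ioi 0))
      (nhds ((p * (s + 0) ^ r + (1 - p) * (t + 0) ^ r) ^ (2 / r))) :=
    tendsto_nhdsWithin_of_tendsto_nhds (Continuous.tendsto
      (((continuous_const.mul (hc s)).add (continuous_const.mul (hc t))).rpow_const
        fun _ => Or.inr (by positivity)) 0)
  have := le_of_tendsto_of_tendsto h1 h2 (by
    filter_upwards [self_mem_nhdsWithin] with ε hε
    have hε : 0 < ε := hε
    exact two_point_of_pos hp0 hp hu hq hr (by positivity) (by positivity))
  simpa only [add_zero] using this

end BiasedCube

/-! ### Tensorization. -/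

namespace BiasedCube

lemma sum_fin_cons {α : Type*} [Fintype α] {n : ℕ} (g : (Fin (n + 1) → α) → ℝ) :
    ∑ x, g x = ∑ a, ∑ x : Fin n → α, g (Fin.cons a x) := by
  rw [← (Fin.consEquiv fun _ : Fin (n + 1) => α).sum_comp, Fintype.sum_prod_type]
  rfl

/-- Tensorization of the two-function hypercontractive inequality for a nonnegative kernel. -/
lemma sum_prod_kernel_le {α : Type*} [Fintype α] {k : α → α → ℝ} {w : α → ℝ} {r : ℝ}
    (hk : ∀ x y, 0 ≤ k x y) (hw : ∀ x, 0 ≤ w x) (hr : 0 < r)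
    (h : ∀ F H : α → ℝ, (∀ x, 0 ≤ F x) → (∀ x, 0 ≤ H x) →
      ∑ x, ∑ y, k x y * (F x * H y) ≤
        √(∑ x, w x * F x ^ 2) * (∑ x, w x * H x ^ r) ^ (1 / r)) (n : ℕ) :
    ∀ F H : (Fin n → α) → ℝ, (∀ x, 0 ≤ F x) → (∀ x, 0 ≤ H x) →
      ∑ x, ∑ y, (∏ i, k (x i) (y i)) * (F x * H y) ≤
        √(∑ x, (∏ i, w (x i)) * F x ^ 2) *
          (∑ x, (∏ i, w (x i)) * H x ^ r) ^ (1 / r) := by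
  induction n with
  | zero =>
    intro F H hF hH
    simp only [Fintype.sum_unique, Finset.univ_eq_empty, Finset.prod_empty, one_mul]
    rw [Real.sqrt_sq (hF _), ← Real.rpow_mul (hH _), mul_one_div_cancel hr.ne', Real.rpow_one]
  | succ n ih =>
    intro F H hF hH
    have hW : ∀ x : Fin n → α, 0 ≤ ∏ i, w (x i) := fun x => Finset.prod_nonneg fun i _ => hw _
    have hN : ∀ b, 0 ≤ ∑ y : Fin n → α, (∏ i, w (y i)) * H (Fin.cons b y) ^ r := fun b =>
      Finset.sum_nonneg fun y _ => mul_nonneg (hW y) (Real.rpow_nonneg (hH _) _)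
    have hM : ∀ a, 0 ≤ ∑ x : Fin n → α, (∏ i, w (x i)) * F (Fin.cons a x) ^ 2 := fun a =>
      Finset.sum_nonneg fun x _ => mul_nonneg (hW x) (sq_nonneg _)
    -- The one-coordinate inequality is applied to the norms of the slices; `k ≥ 0` lets the
    -- induction hypothesis bound each slice.
    have h0 := h (fun a => √(∑ x : Fin n → α, (∏ i, w (x i)) * F (Fin.cons a x) ^ 2))
      (fun b => (∑ y : Fin n → α, (∏ i, w (y i)) * H (Fin.cons b y) ^ r) ^ (1 / r))
      (fun a => Real.sqrt_nonneg _) (fun b => Real.rpow_nonneg (hN b) _)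
    have e1 : ∀ a, √(∑ x : Fin n → α, (∏ i, w (x i)) * F (Fin.cons a x) ^ 2) ^ 2 =
        ∑ x : Fin n → α, (∏ i, w (x i)) * F (Fin.cons a x) ^ 2 := fun a => Real.sq_sqrt (hM a)
    have e2 : ∀ b, ((∑ y : Fin n → α, (∏ i, w (y i)) * H (Fin.cons b y) ^ r) ^ (1 / r)) ^ r =
        ∑ y : Fin n → α, (∏ i, w (y i)) * H (Fin.cons b y) ^ r := fun b => by
      rw [← Real.rpow_mul (hN b), one_div_mul_cancel hr.ne', Real.rpow_one]
    simp only [e1, e2] at h0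
    simp only [sum_fin_cons, Fin.prod_univ_succ, Fin.cons_zero, Fin.cons_succ, mul_assoc,
      ← Finset.mul_sum]
    refine le_trans (Finset.sum_le_sum fun a _ => ?_) h0
    rw [Finset.sum_comm]
    refine Finset.sum_le_sum fun b _ => ?_
    rw [← Finset.mul_sum]
    exact mul_le_mul_of_nonneg_left
      (ih (fun x => F (Fin.cons a x)) (fun y => H (Fin.cons b y)) (fun _ => hF _) fun _ => hH _)
      (hk a b)

/-! ### The biased measure as weighted sums, and the one-coordinate kernel. -/

instance instIsFiniteMeasureCoin (p : ℝ) : IsFiniteMeasure (coin p) := by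
  unfold coin
  constructor
  simp

instance instIsFiniteMeasureMu (n : ℕ) (p : ℝ) : IsFiniteMeasure (mu n p) := by
  unfold mu; infer_instance

lemma isProbabilityMeasure_mu {n : ℕ} {p : ℝ} (hp0 : 0 < p) (hp1 : p < 1) :
    IsProbabilityMeasure (mu n p) := by
  have : IsProbabilityMeasure (coin p) := ⟨by
    simp only [coin, Measure.coe_add, Measure.coe_smul, Pi.add_apply, Pi.smul_apply, measure_univ,
      smul_eq_mul, mul_one]
    rw [← ENNReal.ofReal_add hp0.le (by linarith)]
    simp⟩
  unfold mu; infer_instance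

/-- The weight of a point under the biased coin. -/
noncomputable def wt (p : ℝ) (t : ℤˣ) : ℝ := (coin p).real {t}

lemma wt_one {p : ℝ} (hp0 : 0 < p) : wt p 1 = p := by
  simp [wt, coin, Measure.real, hp0.le]

lemma wt_neg_one {p : ℝ} (hp1 : p < 1) : wt p (-1) = 1 - p := by
  simp [wt, coin, Measure.real, hp1.le]

lemma wt_nonneg (p : ℝ) (t : ℤˣ) : 0 ≤ wt p t := measureReal_nonneg

lemma sum_units (g : ℤˣ → ℝ) : ∑ t, g t = g 1 + g (-1) := by
  have : (Finset.univ : Finset ℤˣ) = {1, -1} := by decide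
  rw [this, Finset.sum_pair (by decide)]

lemma integral_coin {p : ℝ} (hp0 : 0 < p) (hp1 : p < 1) (g : ℤˣ → ℝ) :
    ∫ t, g t ∂coin p = p * g 1 + (1 - p) * g (-1) := by
  rw [integral_fintype Integrable.of_finite, sum_units]
  change wt p 1 * g 1 + wt p (-1) * g (-1) = _
  rw [wt_one hp0, wt_neg_one hp1]

lemma integral_mu {n : ℕ} (p : ℝ) (g : (Fin n → ℤˣ) → ℝ) :
    ∫ x, g x ∂mu n p = ∑ x, (∏ i, wt p (x i)) * g x := by
  rw [integral_fintype Integrable.of_finite]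
  refine Finset.sum_congr rfl fun x _ => ?_
  simp [mu, wt, Measure.real, Measure.pi_singleton, ENNReal.toReal_prod]

/-- The normalized coordinate. -/
noncomputable def coord (p : ℝ) (t : ℤˣ) : ℝ := (1 / sd p) * (toReal t - mean p)

lemma mean_eq {p : ℝ} (hp0 : 0 < p) (hp1 : p < 1) : mean p = 2 * p - 1 := by
  rw [mean, integral_coin hp0 hp1]; simp [toReal]; ring

lemma sd_sq {p : ℝ} (hp0 : 0 < p) (hp1 : p < 1) : sd p ^ 2 = 4 * (p * (1 - p)) := by
  have hq : 0 < 1 - p := by linarith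
  rw [sd, integral_coin hp0 hp1, mean_eq hp0 hp1, Real.sq_sqrt (by positivity)]
  simp [toReal]; ring

lemma coord_mul {p : ℝ} (hp0 : 0 < p) (hp1 : p < 1) (s t : ℤˣ) :
    coord p s * coord p t =
      (toReal s - (2 * p - 1)) * (toReal t - (2 * p - 1)) / (4 * (p * (1 - p))) := by
  rw [coord, coord, ← sd_sq hp0 hp1, mean_eq hp0 hp1]
  ring

/-- The density of the smoothing operator on one coordinate. -/
noncomputable def kernel (p δ : ℝ) (s t : ℤˣ) : ℝ :=
  wt p s * wt p t * (1 + δ * (coord p s * coord p t))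

lemma kernel_values {p : ℝ} (hp0 : 0 < p) (hp1 : p < 1) (δ : ℝ) :
    kernel p δ 1 1 = p * (p + δ * (1 - p)) ∧ kernel p δ 1 (-1) = p * (1 - p) * (1 - δ) ∧
      kernel p δ (-1) 1 = p * (1 - p) * (1 - δ) ∧
      kernel p δ (-1) (-1) = (1 - p) * ((1 - p) + δ * p) := by
  have hq : 1 - p ≠ 0 := by linarith
  have hp := hp0.ne'
  refine ⟨?_, ?_, ?_, ?_⟩ <;>
    simp only [kernel, coord_mul hp0 hp1, wt_one hp0, wt_neg_one hp1, toReal, Units.val_one,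
      Units.val_neg, Int.cast_one, Int.cast_neg] <;> field_simp <;> ring

lemma kernel_nonneg {p δ : ℝ} (hp0 : 0 < p) (hp1 : p < 1) (hδ0 : 0 ≤ δ) (hδ1 : δ ≤ 1)
    (s t : ℤˣ) : 0 ≤ kernel p δ s t := by
  obtain ⟨h1, h2, h3, h4⟩ := kernel_values hp0 hp1 δ
  have hq : 0 < 1 - p := by linarith
  have hd : 0 ≤ 1 - δ := by linarith
  rcases Int.units_eq_one_or s with rfl | rfl <;> rcases Int.units_eq_one_or t with rfl | rfl
  · rw [h1]; positivity
  · rw [h2]; positivity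
  · rw [h3]; positivity
  · rw [h4]; positivity

/-! ### The bilinear inequality on one biased coordinate. -/

/-- `u = log ((1 - λ) / λ)`. -/
noncomputable def logRatio (p : ℝ) : ℝ := Real.log ((1 - lam p) / lam p)

lemma lam_pos {p : ℝ} (hp0 : 0 < p) (hp1 : p < 1) : 0 < lam p := lt_min hp0 (by linarith)

lemma lam_le_half (p : ℝ) : lam p ≤ 1 / 2 := by
  rcases le_total p (1 / 2) with h | h
  · exact (min_le_left _ _).trans h
  · exact (min_le_right _ _).trans (by linarith)

lemma logRatio_nonneg {p : ℝ} (hp0 : 0 < p) (hp1 : p < 1) : 0 ≤ logRatio p :=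
  Real.log_nonneg ((one_le_div (lam_pos hp0 hp1)).2 (by linarith [lam_le_half p]))

lemma two_point_biased {p q r s t : ℝ} (hp0 : 0 < p) (hp1 : p < 1) (hq : 2 ≤ q)
    (hr : r = q / (q - 1)) (hs : 0 ≤ s) (ht : 0 ≤ t) :
    (p * s + (1 - p) * t) ^ 2 + hyperRatio (logRatio p) q * (p * (1 - p) * (s - t) ^ 2) ≤
      (p * s ^ r + (1 - p) * t ^ r) ^ (2 / r) := by
  rcases le_total p (1 - p) with h | h
  · have hl : lam p = p := min_eq_left h
    exact two_point hp0 h (by rw [logRatio, hl]) hq hr hs ht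
  · have hl : lam p = 1 - p := min_eq_right h
    have := two_point (p := 1 - p) (u := logRatio p) (by linarith) (by linarith)
      (by rw [logRatio, hl]) hq hr ht hs
    rw [sub_sub_cancel] at this
    convert this using 1
    · ring
    · rw [add_comm]

lemma sum_kernel_le {p q r δ : ℝ} (hp0 : 0 < p) (hp1 : p < 1) (hq : 2 ≤ q)
    (hr : r = q / (q - 1)) (hδ : δ ^ 2 ≤ hyperRatio (logRatio p) q)
    (F H : ℤˣ → ℝ) (hH : ∀ t, 0 ≤ H t) :
    ∑ s, ∑ t, kernel p δ s t * (F s * H t) ≤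
      √(∑ s, wt p s * F s ^ 2) * (∑ s, wt p s * H s ^ r) ^ (1 / r) := by
  obtain ⟨h1, h2, h3, h4⟩ := kernel_values hp0 hp1 δ
  have hq' : 0 < 1 - p := by linarith
  simp only [sum_units, h1, h2, h3, h4, wt_one hp0, wt_neg_one hp1]
  have hS : 0 ≤ p * H 1 ^ r + (1 - p) * H (-1) ^ r := by
    have := Real.rpow_nonneg (hH 1) r; have := Real.rpow_nonneg (hH (-1)) r; positivity
  have key : √((p * H 1 + (1 - p) * H (-1)) ^ 2 + δ ^ 2 * (p * (1 - p) * (H 1 - H (-1)) ^ 2)) ≤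
      (p * H 1 ^ r + (1 - p) * H (-1) ^ r) ^ (1 / r) := by
    apply Real.sqrt_le_iff.2 ⟨Real.rpow_nonneg hS _, ?_⟩
    rw [← Real.rpow_two (_ ^ (1 / r)), ← Real.rpow_mul hS, one_div_mul_eq_div]
    refine le_trans ?_ (two_point_biased hp0 hp1 hq hr (hH 1) (hH (-1)))
    gcongr
  refine le_trans ?_ (mul_le_mul_of_nonneg_left key (Real.sqrt_nonneg _))
  rw [← Real.sqrt_mul (by positivity)]
  apply Real.le_sqrt_of_sq_le
  -- The remainder in Cauchy–Schwarz (Lagrange's identity) for `F` and `T H`, where `T H` is the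
  -- mean of `H` plus `δ` times its deviation.
  have := sq_nonneg (F 1 * (p * H 1 + (1 - p) * H (-1) - δ * p * (H 1 - H (-1))) -
    F (-1) * (p * H 1 + (1 - p) * H (-1) + δ * (1 - p) * (H 1 - H (-1))))
  linarith [mul_nonneg (mul_nonneg hp0.le hq'.le) this]

/-! ### From the kernel to the smoothing operator. -/

lemma smooth_eq {n : ℕ} (p δ : ℝ) (f : (Fin n → ℤˣ) → ℝ) (x : Fin n → ℤˣ) :
    smooth p δ f x =
      ∑ y, (∏ i, wt p (y i)) * f y * ∏ i, (1 + δ * (coord p (y i) * coord p (x i))) := by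
  simp only [smooth, fourierCoeff, integral_mu, Finset.prod_one_add, Finset.powerset_univ,
    Finset.mul_sum, Finset.sum_mul]
  rw [Finset.sum_comm]
  refine Finset.sum_congr rfl fun y _ => Finset.sum_congr rfl fun S _ => ?_
  rw [Finset.prod_mul_distrib, Finset.prod_mul_distrib, Finset.prod_const]
  simp only [chi, coord]
  ring

lemma wt_mul_abs_smooth_le {n : ℕ} {p δ : ℝ} (hp0 : 0 < p) (hp1 : p < 1) (hδ0 : 0 ≤ δ)
    (hδ1 : δ ≤ 1) (f : (Fin n → ℤˣ) → ℝ) (x : Fin n → ℤˣ) :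
    (∏ i, wt p (x i)) * |smooth p δ f x| ≤ ∑ y, (∏ i, kernel p δ (y i) (x i)) * |f y| := by
  have hW : 0 ≤ ∏ i, wt p (x i) := Finset.prod_nonneg fun i _ => wt_nonneg _ _
  rw [← abs_of_nonneg hW, ← abs_mul, smooth_eq, Finset.mul_sum]
  refine (Finset.abs_sum_le_sum_abs _ _).trans (Finset.sum_le_sum fun y _ => le_of_eq ?_)
  rw [← abs_of_nonneg (Finset.prod_nonneg fun i _ => kernel_nonneg hp0 hp1 hδ0 hδ1 (y i) (x i)),
    ← abs_mul]
  simp only [kernel, Finset.prod_mul_distrib]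
  congr 1
  ring

lemma eLpNorm_mu {n : ℕ} (p : ℝ) (f : (Fin n → ℤˣ) → ℝ) {q : ℝ≥0∞} (hq0 : q ≠ 0) (hq : q ≠ ∞) :
    eLpNorm f q (mu n p) =
      ENNReal.ofReal ((∑ x, (∏ i, wt p (x i)) * |f x| ^ q.toReal) ^ (q.toReal)⁻¹) := by
  rw [MemLp.eLpNorm_eq_integral_rpow_norm hq0 hq MemLp.of_discrete, integral_mu]
  simp only [Real.norm_eq_abs]

/-- Hypercontractivity with the optimal parameter, for finite exponents. -/
theorem eLpNorm_smooth_le {n : ℕ} {p δ : ℝ} {q : ℝ≥0∞} (hp0 : 0 < p) (hp1 : p < 1)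
    (hq : 2 ≤ q) (hq' : q ≠ ∞) (hδ0 : 0 ≤ δ) (hδ : δ ^ 2 ≤ hyperRatio (logRatio p) q.toReal)
    (f : (Fin n → ℤˣ) → ℝ) :
    eLpNorm (smooth p δ f) q (mu n p) ≤ eLpNorm f 2 (mu n p) := by
  have hq0 : q ≠ 0 := by rintro rfl; simp at hq
  have hQ : 2 ≤ q.toReal := by simpa using ENNReal.toReal_mono hq' hq
  rw [eLpNorm_mu p _ hq0 hq', eLpNorm_mu p _ two_ne_zero ENNReal.ofNat_ne_top]
  apply ENNReal.ofReal_le_ofReal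
  set Q := q.toReal
  -- This bound makes the kernel nonnegative.
  have hδ1 : δ ≤ 1 := by
    have := hδ.trans (hyperRatio_le_one (logRatio_nonneg hp0 hp1) hQ)
    exact (sq_le_one_iff₀ hδ0).1 this
  obtain ⟨r, hr⟩ : ∃ r, r = Q / (Q - 1) := ⟨_, rfl⟩
  have hQ1 : 0 < Q - 1 := by linarith
  have hQ0 : 0 < Q := by linarith
  have hr0 : 0 < r := by rw [hr]; positivity
  have hT := sum_prod_kernel_le (kernel_nonneg hp0 hp1 hδ0 hδ1) (wt_nonneg p) hr0
    (fun F H _ hH => sum_kernel_le hp0 hp1 hQ hr hδ F H hH) n (fun x => |f x|)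
    (fun x => |smooth p δ f x| ^ (Q - 1)) (fun _ => abs_nonneg _)
    (fun _ => Real.rpow_nonneg (abs_nonneg _) _)
  obtain ⟨N, hN⟩ : ∃ N, N = ∑ x, (∏ i, wt p (x i)) * |smooth p δ f x| ^ Q := ⟨_, rfl⟩
  have hN0 : 0 ≤ N := by
    rw [hN]
    exact Finset.sum_nonneg fun x _ => mul_nonneg (Finset.prod_nonneg fun i _ => wt_nonneg _ _)
      (Real.rpow_nonneg (abs_nonneg _) _)
  have e1 : ∀ x, (|smooth p δ f x| ^ (Q - 1)) ^ r = |smooth p δ f x| ^ Q := fun x => by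
    rw [← Real.rpow_mul (abs_nonneg _), hr, mul_div_cancel₀ _ hQ1.ne']
  simp only [e1, ← hN] at hT
  -- Since `(q-1) r = q`, the test function `|T f|^(q-1)` has `L^r` norm `N^(1/r)`; dividing by it
  -- leaves `N^(1/q) ≤ ‖f‖₂`.
  have hle : N ≤ √(∑ x, (∏ i, wt p (x i)) * |f x| ^ 2) * N ^ (1 / r) := by
    refine le_trans ?_ hT
    rw [Finset.sum_comm, hN]
    refine Finset.sum_le_sum fun x _ => ?_
    have hx : |smooth p δ f x| ^ Q = |smooth p δ f x| * |smooth p δ f x| ^ (Q - 1) := by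
      rcases (abs_nonneg (smooth p δ f x)).eq_or_lt with h | h
      · rw [← h, Real.zero_rpow hQ0.ne', zero_mul]
      · rw [Real.rpow_sub_one h.ne']; field_simp
    rw [hx, ← mul_assoc]
    calc _ ≤ (∑ y, (∏ i, kernel p δ (y i) (x i)) * |f y|) * |smooth p δ f x| ^ (Q - 1) :=
          mul_le_mul_of_nonneg_right (wt_mul_abs_smooth_le hp0 hp1 hδ0 hδ1 f x)
            (Real.rpow_nonneg (abs_nonneg _) _)
      _ = _ := by simp only [Finset.sum_mul, mul_assoc]
  rw [← hN]
  simp only [ENNReal.toReal_ofNat, Real.rpow_two]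
  rw [← one_div (2 : ℝ), ← Real.sqrt_eq_rpow]
  rcases hN0.eq_or_lt with h | h
  · rw [← h, Real.zero_rpow (inv_ne_zero hQ0.ne')]; exact Real.sqrt_nonneg _
  · have hs : N = N ^ Q⁻¹ * N ^ (1 / r) := by
      rw [← Real.rpow_add h, hr, one_div_div]
      have : Q⁻¹ + (Q - 1) / Q = 1 := by field_simp; ring
      rw [this, Real.rpow_one]
    nth_rw 1 [hs] at hle
    exact le_of_mul_le_mul_right hle (Real.rpow_pos_of_pos h _)

/-- This serves `q = ∞`: `T_0 f` is constant, so its norm under a probability measure does not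
depend on the exponent, and `q = 2` suffices. -/
lemma eLpNorm_smooth_zero_le {n : ℕ} {p : ℝ} {q : ℝ≥0∞} (hp0 : 0 < p) (hp1 : p < 1)
    (hq : 2 ≤ q) (f : (Fin n → ℤˣ) → ℝ) :
    eLpNorm (smooth p 0 f) q (mu n p) ≤ eLpNorm f 2 (mu n p) := by
  have := isProbabilityMeasure_mu (n := n) hp0 hp1
  have hc : ∃ c : ℝ, smooth p 0 f = fun _ => c :=
    ⟨∑ y, (∏ i, wt p (y i)) * f y, by ext x; simp [smooth_eq]⟩
  have h2 := eLpNorm_smooth_le (q := 2) (n := n) hp0 hp1 le_rfl ENNReal.ofNat_ne_top le_rfl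
    (by simpa using hyperRatio_nonneg (logRatio_nonneg hp0 hp1) le_rfl) f
  obtain ⟨c, hc⟩ := hc
  have hμ : mu n p ≠ 0 := IsProbabilityMeasure.ne_zero _
  have hq0 : q ≠ 0 := by rintro rfl; simp at hq
  rw [hc, eLpNorm_const c (by norm_num) hμ] at h2
  rw [hc, eLpNorm_const c hq0 hμ]
  simpa using h2

lemma eLpNorm_smooth_gam_le {n : ℕ} {p : ℝ} {q : ℝ≥0∞} {ρ : ℝ → ℝ} (hp0 : 0 < p) (hp1 : p < 1)
    (hq : 2 ≤ q) (f : (Fin n → ℤˣ) → ℝ) (hρ0 : ∀ q, 2 ≤ q → 0 ≤ ρ q)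
    (hρ : ∀ q, 2 ≤ q → 1 / (q - 1) * ρ q ^ 2 ≤ hyperRatio (logRatio p) q) :
    eLpNorm (smooth p (gam ρ q) f) q (mu n p) ≤ eLpNorm f 2 (mu n p) := by
  by_cases hq' : q = ∞
  · rw [gam, if_pos hq']; exact eLpNorm_smooth_zero_le hp0 hp1 hq f
  · have hQ : 2 ≤ q.toReal := by simpa using ENNReal.toReal_mono hq' hq
    rw [gam, if_neg hq']
    refine eLpNorm_smooth_le hp0 hp1 hq hq' (mul_nonneg (by positivity) (hρ0 _ hQ)) ?_ f
    rw [mul_pow, div_pow, Real.sq_sqrt (by linarith), one_pow]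
    exact hρ _ hQ

/-! ### Comparison of the three parameters with `hyperRatio`. -/

lemma exp_neg_logRatio {p : ℝ} (hp0 : 0 < p) (hp1 : p < 1) :
    Real.exp (-logRatio p) = lam p / (1 - lam p) := by
  have := lam_pos hp0 hp1
  have := lam_le_half p
  rw [logRatio, ← Real.log_inv, inv_div, Real.exp_log]
  apply div_pos <;> linarith

lemma log_lam_div (p : ℝ) : Real.log (lam p / (1 - lam p)) = -logRatio p := by
  rw [logRatio, ← Real.log_inv, inv_div]

lemma logRatio_eq_zero_iff {p : ℝ} (hp0 : 0 < p) (hp1 : p < 1) :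
    logRatio p = 0 ↔ lam p = 1 / 2 := by
  have h0 := lam_pos hp0 hp1
  have h1 : 0 < 1 - lam p := by linarith [lam_le_half p]
  constructor
  · intro h
    have := exp_neg_logRatio hp0 hp1
    rw [h, neg_zero, Real.exp_zero, eq_div_iff h1.ne'] at this
    linarith
  · intro h
    rw [logRatio, h]; norm_num

lemma rhoSinh_sq {p q : ℝ} (hp0 : 0 < p) (hp1 : p < 1) (hq : 2 ≤ q) :
    1 / (q - 1) * rhoSinh p q ^ 2 = hyperRatio (logRatio p) q := by
  unfold rhoSinh
  split_ifs with h
  · rw [hyperRatio, if_pos ((logRatio_eq_zero_iff hp0 hp1).2 h)]; simp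
  · have hu : logRatio p ≠ 0 := fun h' => h ((logRatio_eq_zero_iff hp0 hp1).1 h')
    have h0 := hyperRatio_nonneg (logRatio_nonneg hp0 hp1) hq
    have hq1 : q - 1 ≠ 0 := by linarith
    have e : Real.sinh (-(1 / q) * Real.log (lam p / (1 - lam p))) /
        Real.sinh (-(1 - 1 / q) * Real.log (lam p / (1 - lam p))) =
        hyperRatio (logRatio p) q := by
      rw [hyperRatio, if_neg hu, log_lam_div]
      congr 2 <;> ring
    rw [e, mul_pow, Real.sq_sqrt (by linarith), Real.sq_sqrt h0]
    field_simp

lemma one_sub_two_div_mem {q : ℝ} (hq : 2 ≤ q) : 0 ≤ 1 - 2 / q ∧ 1 - 2 / q ≤ 1 := by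
  have h1 : 2 / q ≤ 1 := (div_le_one (by linarith)).2 hq
  have h2 : 0 ≤ 2 / q := by positivity
  constructor <;> linarith

lemma rhoPow_sq_le {p q : ℝ} (hp0 : 0 < p) (hp1 : p < 1) (hq : 2 ≤ q) :
    rhoPow p q ^ 2 ≤ Real.exp (-(1 - 2 / q) * logRatio p) := by
  have h0 := lam_pos hp0 hp1
  have h1 : 0 < 1 - lam p := by linarith [lam_le_half p]
  have e1 : rhoPow p q ^ 2 = lam p ^ (1 - 2 / q) := by
    rw [rhoPow, ← Real.rpow_natCast, ← Real.rpow_mul h0.le]; congr 1; push_cast; ring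
  have e2 : Real.exp (-(1 - 2 / q) * logRatio p) = (lam p / (1 - lam p)) ^ (1 - 2 / q) := by
    rw [← exp_neg_logRatio hp0 hp1, ← Real.exp_mul]; congr 1; ring
  rw [e1, e2]
  -- The bound only discards the denominator: `λ ≤ λ/(1-λ)`.
  refine Real.rpow_le_rpow h0.le ?_ (one_sub_two_div_mem hq).1
  rw [le_div_iff₀ h1]
  nlinarith

lemma rhoRatio_sq_le {p q : ℝ} (hp0 : 0 < p) (hp1 : p < 1) (hq : 2 ≤ q) :
    rhoRatio p q ^ 2 ≤ Real.exp (-(1 - 2 / q) * logRatio p) := by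
  rw [rhoRatio, ← exp_neg_logRatio hp0 hp1, Real.sq_sqrt (Real.exp_pos _).le, Real.exp_le_exp]
  nlinarith [one_sub_two_div_mem hq, logRatio_nonneg hp0 hp1]

end BiasedCube

theorem theorem2 (n : ℕ) (p : ℝ) (hp0 : 0 < p) (hp1 : p < 1) (f : (Fin n → ℤˣ) → ℝ)
    (q : ℝ≥0∞) (hq : 2 ≤ q) :
    eLpNorm (BiasedCube.smooth p (BiasedCube.gam (BiasedCube.rhoPow p) q) f) q
        (BiasedCube.mu n p) ≤ eLpNorm f 2 (BiasedCube.mu n p) ∧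
    eLpNorm (BiasedCube.smooth p (BiasedCube.gam (BiasedCube.rhoSinh p) q) f) q
        (BiasedCube.mu n p) ≤ eLpNorm f 2 (BiasedCube.mu n p) ∧
    eLpNorm (BiasedCube.smooth p (BiasedCube.gam (BiasedCube.rhoRatio p) q) f) q
        (BiasedCube.mu n p) ≤ eLpNorm f 2 (BiasedCube.mu n p) := by
  have hexp : ∀ (ρ : ℝ → ℝ) (q : ℝ), 2 ≤ q →
      ρ q ^ 2 ≤ Real.exp (-(1 - 2 / q) * BiasedCube.logRatio p) →
      1 / (q - 1) * ρ q ^ 2 ≤ BiasedCube.hyperRatio (BiasedCube.logRatio p) q :=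
    fun ρ q hq h => (mul_le_mul_of_nonneg_left h
      (div_nonneg zero_le_one (by linarith))).trans
        (BiasedCube.exp_mul_le_hyperRatio (BiasedCube.logRatio_nonneg hp0 hp1) hq)
  refine ⟨?_, ?_, ?_⟩
  · exact BiasedCube.eLpNorm_smooth_gam_le hp0 hp1 hq f
      (fun q _ => Real.rpow_nonneg (BiasedCube.lam_pos hp0 hp1).le _)
      (fun q hq => hexp _ q hq (BiasedCube.rhoPow_sq_le hp0 hp1 hq))
  · refine BiasedCube.eLpNorm_smooth_gam_le hp0 hp1 hq f (fun q _ => ?_)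
      (fun q hq => (BiasedCube.rhoSinh_sq hp0 hp1 hq).le)
    unfold BiasedCube.rhoSinh
    split_ifs <;> positivity
  · exact BiasedCube.eLpNorm_smooth_gam_le hp0 hp1 hq f (fun q _ => Real.sqrt_nonneg _)
      (fun q hq => hexp _ q hq (BiasedCube.rhoRatio_sq_le hp0 hp1 hq))
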